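/- Let $\mathbb K$ be a field and let $m,n\ge 2$ be integers. Let $K_n$ be the complete graph on $[n]=\{1,\dots,n\}$, let $W\subseteq[n]$, let $W=W_1\sqcup\cdots\sqcup W_k$ be a partition of $W$ into $k\ge 0$ nonempty parts (with $W=\emptyset$ if $k=0$), write $W_i=\{w_{i,1},\dots,w_{i,r_i}\}$ with $r_i=|W_i|$, and let $a_{i,j}>j$ be integers for $1\le i\le k$, $1\le j\le r_i$. The corresponding $k$-fan graph $G=F_k^W(K_n)$ is obtained from $K_n$ by attaching, for all $i,j$, a complete graph $K_{a_{i,j}}$ on $w_{i,1},\dots,w_{i,j}$ and $a_{i,j}-j$ new vertices, where the sets of new vertices for distinct pairs $(i,j)$ are disjoint; for $k=0$, $G=K_n$. Let $S=\mathbb K[x_{i,v} : i\in[m],\ v\in V(G)]$ and let $$\mathcal J_{K_m,G}=\bigl(x_{i,u}x_{j,v}-x_{i,v}x_{j,u} : 1\le i<j\le m,\ \{u,v\}\in E(G)\bigr)\subseteq S$$ be the generalized binomial edge ideal of $G$. Then the Krull dimension of $S/\mathcal J_{K_m,G}$ is $$\dim(S/\mathcal J_{K_m,G})=m+|V(G)|-1+s(m-2),\qquad\text{where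 } s=\min\{|W|,n-1\}.$$ -/

import Mathlib

/-- The binomial edge ideal `𝒥_{G₁,G₂}` of a pair of simple graphs: the ideal of the polynomial ring
`K[x_{i,t} : i ∈ V(G₁), t ∈ V(G₂)]` generated by the `2`-minors
`[i,j | t,l] = x_{i,t} x_{j,l} - x_{i,l} x_{j,t}` with `{i,j} ∈ E(G₁)` and `{t,l} ∈ E(G₂)`.
(Exchanging the endpoints of an edge changes the minor only by a sign, so no order on the
vertices is needed.) -/
noncomputable def pairBinomialEdgeIdeal (K : Type*) [Field K] {U V : Type*}
    (G₁ : SimpleGraph U) (G₂ : SimpleGraph V) : Ideal (MvPolynomial (U × V) K) :=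
  Ideal.span {p | ∃ i j : U, ∃ t l : V, G₁.Adj i j ∧ G₂.Adj t l ∧
    p = MvPolynomial.X (i, t) * MvPolynomial.X (j, l)
      - MvPolynomial.X (i, l) * MvPolynomial.X (j, t)}

/-- The generalized binomial edge ideal `𝒥_{K_m,G}`, in `K[x_{i,v} : i ∈ [m], v ∈ V(G)]`. -/
noncomputable def genBinomialEdgeIdeal (K : Type*) [Field K] (m : ℕ) {V : Type*} (G : SimpleGraph V) :
    Ideal (MvPolynomial (Fin m × V) K) :=
  pairBinomialEdgeIdeal K (⊤ : SimpleGraph (Fin m)) G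

/-- The combinatorial data from which a `k`-fan graph `F_k^W(K_n)` is built: a partition
`W = W_1 ⊔ ⋯ ⊔ W_k` of a set `W` of vertices of `K_n` into nonempty parts, an enumeration
`W_i = {w_{i,1}, …, w_{i,r_i}}` of each part, and sizes `a_{i,j} > j` of the complete graphs
`K_{a_{i,j}}` to be attached. Indices start at `0` here, so that the mathematical index `j` is
`(j : ℕ) + 1` for `j : Fin (r i)`. For `k = 0` this forces `W = ∅`. -/
structure FanData (n k : ℕ) (W : Finset (Fin n)) where
  /-- The size of the part `W_i`. -/
  r : Fin k → ℕ
  r_pos : ∀ i, 0 < r i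
  /-- The vertex `w_{i,j}`. -/
  w : (i : Fin k) → Fin (r i) → Fin n
  w_injective : Function.Injective fun p : (i : Fin k) × Fin (r i) => w p.1 p.2
  mem_W_iff : ∀ x, x ∈ W ↔ ∃ i j, w i j = x
  /-- The number of vertices of the complete graph attached along `w_{i,1}, …, w_{i,j}`. -/
  a : (i : Fin k) → Fin (r i) → ℕ
  lt_a : ∀ (i : Fin k) (j : Fin (r i)), (j : ℕ) + 1 < a i j

namespace FanData

variable {n k : ℕ} {W : Finset (Fin n)} (F : FanData n k W)

/-- `h_{i,j} = a_{i,j} - j`, the number of new vertices of `K_{a_{i,j}}`. -/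
def h (i : Fin k) (j : Fin (F.r i)) : ℕ := F.a i j - ((j : ℕ) + 1)

/-- The vertices of the fan graph: those of `K_n`, and for each `(i, j)` the `h_{i,j}` new
vertices of `K_{a_{i,j}}`. -/
abbrev Vert : Type := Fin n ⊕ ((p : (i : Fin k) × Fin (F.r i)) × Fin (F.h p.1 p.2))

/-- The vertex set of `K_n` in the fan graph. -/
def base : Set F.Vert := Set.range Sum.inl

/-- The vertex set of `K_{a_{i,j}}` in the fan graph: `w_{i,1}, …, w_{i,j}` and the new
vertices with index `(i, j)`. -/
def branch (i : Fin k) (j : Fin (F.r i)) : Set F.Vert :=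
  {v | (∃ l : Fin (F.r i), l ≤ j ∧ v = Sum.inl (F.w i l)) ∨
    ∃ c : Fin (F.h i j), v = Sum.inr ⟨⟨i, j⟩, c⟩}

/-- The fan graph `F_k^W(K_n)`: the union of the complete graphs on the vertex sets of `K_n` and
of all the `K_{a_{i,j}}`. -/
def graph : SimpleGraph F.Vert where
  Adj u v := u ≠ v ∧ ((u ∈ F.base ∧ v ∈ F.base) ∨ ∃ i j, u ∈ F.branch i j ∧ v ∈ F.branch i j)
  symm := ⟨fun _ _ ⟨h, h'⟩ => ⟨h.symm, h'.imp And.symm fun ⟨i, j, hij⟩ => ⟨i, j, hij.symm⟩⟩⟩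
  loopless := ⟨fun _ h => h.1 rfl⟩

end FanData

/-!
The variety of `𝒥_{K_m,G}` consists of the `m × V` matrices whose columns are proportional along the
edges of `G`. If `T` is the set of vertices with vanishing column, then on each connected component
`C` of `G - T` all columns are nonzero multiples of one vector, because proportionality to a nonzero
vector is transitive. Matrices of this kind depend on `m - 1` parameters for the direction of the
vector and `|C|` scalars, so that for every graph
`dim S/𝒥_{K_m,G} = max_T (|V ∖ T| + (m - 1) c(G - T))`, where `c` counts connected components.

Over an arbitrary field this is argued with transcendence degrees, which compute the dimension of
finitely generated domains (`ringKrullDim_eq_trdeg`). For a prime `P` containing the ideal, `S/P`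
embeds into an algebra generated by the parameters listed above for the set `T` of columns that
vanish modulo `P` (`ringKrullDim_quotient_le_cutDim`). Conversely, for each `T` the parametrization by
scalars and vectors normalized to have one coordinate equal to `1` is a map from `S/𝒥_{K_m,G}` to a
polynomial ring in that many variables which is algebraic over the image (`cutDim_le_ringKrullDim`).

For `G = F_k^W(K_n)`, a component of `G - T` either meets `K_n`, and there is at most one such, or
consists of new vertices of a single `K_{a_{i,j}}` with `w_{i,1}, …, w_{i,j} ∈ T`. Sending the latter
to `w_{i,j}` shows that there are at most `|T ∩ W|` of them. So each vertex of `T` costs `1` in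
`|V ∖ T|` and gains at most `m - 1`, a net gain of at most `m - 2`, and if `T` contains `K_n` the
component meeting `K_n` is lost (`FanData.cutDim_le`). Equality is attained by sets `T ⊆ W` of size `min (|W|, n - 1)` that
meet every `W_i` in an initial segment (`FanData.exists_le_cutDim`).
-/

/-! ### Krull dimension and transcendence degree -/

/-- Krull dimension is invariant under injective integral ring extensions: `≤` is incomparability,
`≥` is going up. -/
theorem ringKrullDim_eq_of_isIntegral (R S : Type*) [CommRing R] [CommRing S] [Algebra R S]
    [FaithfulSMul R S] [Algebra.IsIntegral R S] : ringKrullDim R = ringKrullDim S := by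
  apply le_antisymm
  · refine iSup_le fun l ↦ ?_
    obtain ⟨Q, -, hQ, hQl⟩ := Ideal.exists_ideal_over_prime_of_isIntegral (S := S)
      l.head.asIdeal ⊥ (by
        rw [← RingHom.ker_eq_comap_bot,
          (RingHom.injective_iff_ker_eq_bot _).mp (FaithfulSMul.algebraMap_injective R S)]
        exact bot_le)
    have : Q.LiesOver l.head.asIdeal := ⟨hQl.symm⟩
    obtain ⟨L, hL, -, -⟩ := Ideal.exists_ltSeries_of_hasGoingUp l Q
    rw [← hL]
    exact le_iSup (fun L : LTSeries (PrimeSpectrum S) ↦ (L.length : WithBot ℕ∞)) L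
  · exact Order.krullDim_le_of_strictMono (PrimeSpectrum.comap (algebraMap R S))
      fun I J hIJ ↦ Ideal.IsIntegral.comap_lt_comap hIJ

/-- The Krull dimension is attained on quotients by primes, since a chain of primes lives above
its smallest member. -/
theorem ringKrullDim_le_of_forall_isPrime {R : Type*} [CommRing R] {d : WithBot ℕ∞}
    (h : ∀ P : Ideal R, P.IsPrime → ringKrullDim (R ⧸ P) ≤ d) : ringKrullDim R ≤ d := by
  refine iSup_le fun l ↦ le_trans ?_ (h l.head.asIdeal l.head.isPrime)
  rw [ringKrullDim_quotient]
  refine le_iSup_of_le (LTSeries.mk l.length (fun i ↦ ⟨l i, ?_⟩) fun i j hij ↦ ?_) le_rfl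
  · exact LTSeries.head_le l i
  · exact l.strictMono hij

/-- A finitely generated domain over a field has Krull dimension equal to its transcendence
degree: both are the number of variables in a Noether normalization. -/
theorem ringKrullDim_eq_trdeg (K A : Type*) [Field K] [CommRing A] [IsDomain A] [Algebra K A]
    [Algebra.FiniteType K A] :
    ringKrullDim A = (Cardinal.toNat (Algebra.trdeg K A) : WithBot ℕ∞) := by
  obtain ⟨s, g, hg, hint⟩ := exists_integral_inj_algHom_of_fg K A
  algebraize [g.toRingHom]
  have : FaithfulSMul (MvPolynomial (Fin s) K) A :=
    (faithfulSMul_iff_algebraMap_injective _ _).mpr hg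
  have : IsScalarTower K (MvPolynomial (Fin s) K) A := .of_algHom g
  have htr := lift_trdeg_add_eq K (MvPolynomial (Fin s) K) A
  rw [MvPolynomial.trdeg_of_isDomain, trdeg_eq_zero] at htr
  have hs : Cardinal.toNat (Algebra.trdeg K A) = s := by
    have := congrArg Cardinal.toNat htr
    simpa using this.symm
  rw [← ringKrullDim_eq_of_isIntegral (MvPolynomial (Fin s) K) A,
    MvPolynomial.ringKrullDim_of_isNoetherianRing, hs, ringKrullDim_eq_zero_of_field]
  simp

/-- If a domain `A` embeds into an algebra generated by finitely many elements `g s`, then its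
Krull dimension is at most the number of the `g s`. -/
theorem ringKrullDim_le_card_of_injective {K A L σ : Type*} [Field K] [CommRing A] [IsDomain A]
    [Algebra K A] [Algebra.FiniteType K A] [CommRing L] [Algebra K L] [Finite σ]
    (f : A →ₐ[K] L) (hf : Function.Injective f) (g : σ → L)
    (hfg : ∀ a, f a ∈ Algebra.adjoin K (Set.range g)) :
    ringKrullDim A ≤ (Nat.card σ : WithBot ℕ∞) := by
  rw [ringKrullDim_eq_trdeg K A]
  let q := (MvPolynomial.aeval (R := K) g).rangeRestrict
  have hq : Function.Surjective q := AlgHom.rangeRestrict_surjective _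
  have := Algebra.FiniteType.of_surjective q hq
  have h₁ := lift_trdeg_le_of_injective
    (f.codRestrict (MvPolynomial.aeval (R := K) g).range
      (by simpa [Algebra.adjoin_range_eq_range_aeval] using hfg))
    (fun a b h ↦ hf (congrArg Subtype.val h))
  have h₂ := lift_trdeg_le_of_surjective q hq
  rw [MvPolynomial.trdeg_of_isDomain] at h₂
  replace h₁ := Cardinal.toNat_le_toNat h₁ (by simpa using trdeg_lt_aleph0_of_finiteType)
  replace h₂ := Cardinal.toNat_le_toNat h₂ (by simp)
  simp only [Cardinal.toNat_lift] at h₁ h₂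
  exact_mod_cast h₁.trans h₂

/-! ### The dimension of generalized binomial edge ideals -/

open MvPolynomial in
/-- An algebra map out of the polynomial ring kills the binomial edge ideal exactly when the
columns of the matrix of images are proportional along edges. -/
theorem genBinomialEdgeIdeal_le_ker_iff {K V B : Type*} [Field K] [CommRing B] [Algebra K B]
    {m : ℕ} {G : SimpleGraph V} (φ : MvPolynomial (Fin m × V) K →ₐ[K] B) :
    genBinomialEdgeIdeal K m G ≤ RingHom.ker φ ↔
      ∀ i j u v, G.Adj u v → φ (X (i, u)) * φ (X (j, v)) = φ (X (i, v)) * φ (X (j, u)) := by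
  rw [genBinomialEdgeIdeal, pairBinomialEdgeIdeal, Ideal.span_le]
  constructor
  · intro h i j u v huv
    obtain rfl | hij := eq_or_ne i j
    · exact mul_comm _ _
    · simpa [sub_eq_zero] using h ⟨i, j, u, v, hij, huv, rfl⟩
  · rintro h _ ⟨i, j, u, v, -, huv, rfl⟩
    simpa [sub_eq_zero] using h i j u v huv

/-- The number of parameters of the component of the variety of `𝒥_{K_m,G}` attached to a set `T`
of vertices: the matrices whose columns in `T` vanish and whose columns in each connected component
`C` of `G - T` are multiples of a common vector, which is `(m - 1) + |C|` parameters for each `C`. -/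
noncomputable def cutDim (m : ℕ) {V : Type*} (G : SimpleGraph V) (T : Set V) : ℕ :=
  Nat.card ↥Tᶜ + Nat.card (G.induce Tᶜ).ConnectedComponent * (m - 1)

section LowerBound

open MvPolynomial

variable (K : Type*) [Field K] {m : ℕ} {V : Type*} (G : SimpleGraph V) (T : Set V) (i₀ : Fin m)

/-- The coordinates on the component attached to `T`: a scalar for every vertex outside `T`, and for
every connected component of `G - T` a vector with `i₀`-th coordinate `1`. -/
abbrev CutVar : Type _ := ↥Tᶜ ⊕ ((G.induce Tᶜ).ConnectedComponent × {i : Fin m // i ≠ i₀})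

open Classical in
/-- The parametrization of the component attached to `T`, as a map of polynomial rings: the column
of a vertex outside `T` is its scalar times the vector of its connected component. -/
noncomputable def cutParam : MvPolynomial (Fin m × V) K →ₐ[K] MvPolynomial (CutVar G T i₀) K :=
  aeval fun p ↦ if hv : p.2 ∈ Tᶜ then
    X (.inl ⟨p.2, hv⟩) * (if hi : p.1 = i₀ then 1 else
      X (.inr ((G.induce Tᶜ).connectedComponentMk ⟨p.2, hv⟩, ⟨p.1, hi⟩)))
    else 0

theorem genBinomialEdgeIdeal_le_ker_cutParam :
    genBinomialEdgeIdeal K m G ≤ RingHom.ker (cutParam K G T i₀) := by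
  rw [genBinomialEdgeIdeal_le_ker_iff]
  intro i j u v huv
  by_cases hu : u ∈ Tᶜ
  · by_cases hv : v ∈ Tᶜ
    · have hc : (G.induce Tᶜ).connectedComponentMk ⟨u, hu⟩ =
          (G.induce Tᶜ).connectedComponentMk ⟨v, hv⟩ :=
        SimpleGraph.ConnectedComponent.sound (SimpleGraph.Adj.reachable (by simpa using huv))
      simp only [cutParam, aeval_X, dif_pos hu, dif_pos hv, hc]
      ring
    · simp only [cutParam, aeval_X, dif_neg hv, zero_mul, mul_zero]
  · simp only [cutParam, aeval_X, dif_neg hu, zero_mul, mul_zero]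

/-- The parametrization is birational onto its image: the scalars are images of variables, and the
coordinates of the vectors are quotients of images of variables. -/
theorem isAlgebraic_range_cutParam :
    Algebra.IsAlgebraic (cutParam K G T i₀).range (MvPolynomial (CutVar G T i₀) K) := by
  have hz (v : ↥Tᶜ) : X (.inl v) ∈ (cutParam K G T i₀).range :=
    ⟨X (i₀, v), by simp [cutParam]⟩
  have hy (v : ↥Tᶜ) (i : {i : Fin m // i ≠ i₀}) :
      X (.inl v) * X (.inr ((G.induce Tᶜ).connectedComponentMk v, i)) ∈
        (cutParam K G T i₀).range :=
    ⟨X (i.1, v), by simp [cutParam, i.2]⟩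
  refine ⟨fun p ↦ ?_⟩
  induction p using MvPolynomial.induction_on with
  | C a => exact isAlgebraic_algebraMap (⟨C a, C a, by simp⟩ : (cutParam K G T i₀).range)
  | add p q hp hq => exact hp.add hq
  | mul_X p s hp =>
    refine hp.mul ?_
    obtain v | ⟨c, i⟩ := s
    · exact isAlgebraic_algebraMap (⟨_, hz v⟩ : (cutParam K G T i₀).range)
    · induction c using SimpleGraph.ConnectedComponent.ind with
      | h v =>
      -- With `z` the scalar of `v` and `y` the variable at hand, `y` is a root of `z Y - z y`.
      refine ⟨Polynomial.C ⟨_, hz v⟩ * Polynomial.X - Polynomial.C ⟨_, hy v i⟩, fun h ↦ ?_, ?_⟩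
      · have := congrArg (fun q ↦ (q.coeff 1 : (cutParam K G T i₀).range).1) h
        simp at this
      · simp

/-- Every set `T` of vertices gives an irreducible closed subset of dimension `cutDim m G T` of the
variety of `𝒥_{K_m,G}`. -/
theorem cutDim_le_ringKrullDim [Finite V] (hm : 0 < m) :
    (cutDim m G T : WithBot ℕ∞) ≤
      ringKrullDim (MvPolynomial (Fin m × V) K ⧸ genBinomialEdgeIdeal K m G) := by
  let i₀ : Fin m := ⟨0, hm⟩
  let φ := cutParam K G T i₀
  have : Algebra.FiniteType K φ.range := .of_surjective φ.rangeRestrict φ.rangeRestrict_surjective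
  have := isAlgebraic_range_cutParam K G T i₀
  have htr := trdeg_add_eq K φ.range (A := MvPolynomial (CutVar G T i₀) K)
  rw [MvPolynomial.trdeg_of_isDomain, trdeg_eq_zero (R := φ.range),
    add_zero] at htr
  have hcard : Nat.card (CutVar G T i₀) = cutDim m G T := by
    simp [cutDim, Nat.card_sum, Nat.card_prod]
  calc (cutDim m G T : WithBot ℕ∞) = ringKrullDim φ.range := by
        rw [ringKrullDim_eq_trdeg K, htr, Cardinal.toNat_lift, ← hcard]; rfl
    _ ≤ _ := ringKrullDim_le_of_surjective
      (Ideal.Quotient.lift _ φ.rangeRestrict.toRingHom fun a ha ↦ Subtype.ext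
        (genBinomialEdgeIdeal_le_ker_cutParam K G T i₀ ha))
      (Ideal.Quotient.lift_surjective_of_surjective _ _ φ.rangeRestrict_surjective)

end LowerBound

section UpperBound

open MvPolynomial

/-- Proportionality of nonzero columns is transitive, so it propagates from edges to connected
components. -/
theorem SimpleGraph.Reachable.mul_eq_mul {ι V L : Type*} [CommRing L] [IsDomain L]
    {G : SimpleGraph V} {x : ι → V → L} (hx : ∀ v, ∃ i, x i v ≠ 0)
    (hG : ∀ i j u v, G.Adj u v → x i u * x j v = x i v * x j u) {u v : V} (h : G.Reachable u v)
    (i j : ι) : x i u * x j v = x i v * x j u := by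
  obtain ⟨w⟩ := h
  induction w generalizing i j with
  | nil => ring
  | @cons u v w huv _ ih =>
    obtain ⟨k, hk⟩ := hx v
    refine mul_right_cancel₀ hk ?_
    linear_combination x j w * hG i k u v huv + x k u * ih i j - x i w * hG j k u v huv

/-- A domain generated by the entries of a matrix whose columns are proportional along the edges of
`G` has dimension at most `cutDim m G T`, where `T` is the set of vanishing columns: over a field
containing the domain, the columns of a connected component of `G - T` are multiples of a vector
with a coordinate equal to `1`. -/
theorem ringKrullDim_quotient_le_cutDim {K : Type*} [Field K] {m : ℕ} {V : Type*} [Finite V]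
    (G : SimpleGraph V) (P : Ideal (MvPolynomial (Fin m × V) K)) [P.IsPrime]
    (hP : genBinomialEdgeIdeal K m G ≤ P) :
    ∃ T : Set V, ringKrullDim (MvPolynomial (Fin m × V) K ⧸ P) ≤ (cutDim m G T : WithBot ℕ∞) := by
  let A := MvPolynomial (Fin m × V) K ⧸ P
  let L := FractionRing A
  let f : A →ₐ[K] L := IsScalarTower.toAlgHom K A L
  let φ : MvPolynomial (Fin m × V) K →ₐ[K] L := f.comp (Ideal.Quotient.mkₐ K P)
  let x (i : Fin m) (v : V) : L := φ (X (i, v))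
  have hx : ∀ i j u v, G.Adj u v → x i u * x j v = x i v * x j u := by
    refine (genBinomialEdgeIdeal_le_ker_iff φ).mp fun a ha ↦ ?_
    have : Ideal.Quotient.mkₐ K P a = 0 := Ideal.Quotient.eq_zero_iff_mem.mpr (hP ha)
    simp [φ, this]
  let T : Set V := {v | ∀ i, x i v = 0}
  let H := G.induce Tᶜ
  have hT (v : ↥Tᶜ) : ∃ i, x i v ≠ 0 := not_forall.mp v.2
  have hH {u v : ↥Tᶜ} (h : H.Reachable u v) (i j : Fin m) : x i u * x j v = x i v * x j u :=
    SimpleGraph.Reachable.mul_eq_mul (x := fun i (v : ↥Tᶜ) ↦ x i v) hT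
      (fun i j u v huv ↦ hx i j u v (by simpa [H] using huv)) h i j
  -- In a component `c`, the direction is the column of `r c` divided by its nonzero `e c`-th entry,
  -- and the scalar of a vertex is then the `e c`-th entry of its own column.
  choose r hr using fun c : H.ConnectedComponent ↦ c.exists_rep
  choose e he using fun c : H.ConnectedComponent ↦ hT (r c)
  let g : ↥Tᶜ ⊕ ((c : H.ConnectedComponent) × {i : Fin m // i ≠ e c}) → L :=
    Sum.elim (fun v ↦ x (e (H.connectedComponentMk v)) v)
      fun p ↦ x p.2 (r p.1) / x (e p.1) (r p.1)
  refine ⟨T, (ringKrullDim_le_card_of_injective f (IsFractionRing.injective A L) g ?_).trans_eq ?_⟩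
  · have hmem (i : Fin m) (v : V) : x i v ∈ Algebra.adjoin K (Set.range g) := by
      by_cases hv : v ∈ Tᶜ
      · let c := H.connectedComponentMk ⟨v, hv⟩
        have hc : x (e c) v ∈ Algebra.adjoin K (Set.range g) :=
          Algebra.subset_adjoin ⟨.inl ⟨v, hv⟩, rfl⟩
        by_cases hi : i = e c
        · rwa [hi]
        · have : x i v = x (e c) v * (x i (r c) / x (e c) (r c)) := by
            rw [← mul_div_assoc, eq_div_iff (he c)]
            have := hH (SimpleGraph.ConnectedComponent.exact (hr c)) (e c) i
            linear_combination this
          rw [this]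
          exact mul_mem hc (Algebra.subset_adjoin ⟨.inr ⟨c, ⟨i, hi⟩⟩, rfl⟩)
      · rw [show x i v = 0 from not_not.mp hv i]
        exact zero_mem _
    intro a
    obtain ⟨p, rfl⟩ := Ideal.Quotient.mkₐ_surjective K P a
    change φ p ∈ _
    induction p using MvPolynomial.induction_on with
    | C a => rw [← MvPolynomial.algebraMap_eq, AlgHom.commutes]; exact Subalgebra.algebraMap_mem _ a
    | add p q hp hq => rw [map_add]; exact add_mem hp hq
    | mul_X p s hp => rw [map_mul]; exact mul_mem hp (hmem s.1 s.2)
  · have := Fintype.ofFinite H.ConnectedComponent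
    simp [cutDim, Nat.card_sum, H]

/-- The variety of `𝒥_{K_m,G}` is the union of the closed subsets attached to the sets `T`. -/
theorem ringKrullDim_le_of_forall_cutDim_le {K : Type*} [Field K] {m : ℕ} {V : Type*} [Finite V]
    {G : SimpleGraph V} {d : ℕ} (hd : ∀ T, cutDim m G T ≤ d) :
    ringKrullDim (MvPolynomial (Fin m × V) K ⧸ genBinomialEdgeIdeal K m G) ≤ d := by
  refine ringKrullDim_le_of_forall_isPrime fun P hP ↦ ?_
  let π := Ideal.Quotient.mk (genBinomialEdgeIdeal K m G)
  obtain ⟨T, hT⟩ := ringKrullDim_quotient_le_cutDim G (P.comap π)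
    (Ideal.mk_ker.symm.le.trans (Ideal.comap_mono bot_le))
  refine le_trans ?_ (hT.trans (by exact_mod_cast hd T))
  exact ringKrullDim_le_of_surjective (Ideal.quotientMap P π le_rfl)
    (Ideal.quotientMap_surjective Ideal.Quotient.mk_surjective)

end UpperBound

open MvPolynomial in
/-- Renaming the vertices maps the binomial edge ideal into that of an isomorphic graph. -/
theorem SimpleGraph.Iso.ringKrullDim_genBinomialEdgeIdeal_le (K : Type*) [Field K] (m : ℕ)
    {V V' : Type*} {G : SimpleGraph V} {G' : SimpleGraph V'} (e : G ≃g G') :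
    ringKrullDim (MvPolynomial (Fin m × V') K ⧸ genBinomialEdgeIdeal K m G') ≤
      ringKrullDim (MvPolynomial (Fin m × V) K ⧸ genBinomialEdgeIdeal K m G) := by
  let ρ := (renameEquiv K ((Equiv.refl (Fin m)).prodCongr e.toEquiv)).toRingEquiv
  refine ringKrullDim_le_of_surjective (Ideal.quotientMap _ ρ.toRingHom ?_)
    (Ideal.quotientMap_surjective ρ.surjective)
  refine Ideal.span_le.mpr ?_
  rintro _ ⟨i, j, u, v, hij, huv, rfl⟩
  refine Ideal.subset_span ⟨i, j, e u, e v, hij, e.map_adj_iff.mpr huv, ?_⟩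
  simp [ρ]

/-! ### Connected components of a fan graph minus a set of vertices -/

/-- A labelling that is constant on edges has at most as many values as there are components. -/
theorem SimpleGraph.ncard_range_le_card_connectedComponent {V β : Type*} [Finite V]
    {G : SimpleGraph V} (f : V → β) (hf : ∀ u v, G.Adj u v → f u = f v) :
    (Set.range f).ncard ≤ Nat.card G.ConnectedComponent := by
  have hwalk {u v : V} (p : G.Walk u v) : f u = f v := by
    induction p with
    | nil => rfl
    | cons h _ ih => exact (hf _ _ h).trans ih
  have hr : Set.range f ⊆
      Set.range (SimpleGraph.ConnectedComponent.lift f fun _ _ p (_ : p.IsPath) ↦ hwalk p) := by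
    rintro _ ⟨v, rfl⟩
    exact ⟨G.connectedComponentMk v, rfl⟩
  exact (Set.ncard_le_ncard hr).trans (by
    rw [← Nat.card_coe_set_eq]
    exact Nat.card_le_card_of_surjective _ Set.rangeFactorization_surjective)

/-- A labelling that separates components has at least as many values as there are components. -/
theorem SimpleGraph.card_connectedComponent_le_ncard_range {V β : Type*} [Finite V]
    {G : SimpleGraph V} (f : V → β) (hf : ∀ u v, f u = f v → G.Reachable u v) :
    Nat.card G.ConnectedComponent ≤ (Set.range f).ncard := by
  choose r hr using fun c : G.ConnectedComponent ↦ c.exists_rep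
  rw [← Nat.card_coe_set_eq]
  refine Nat.card_le_card_of_injective (fun c ↦ ⟨f (r c), Set.mem_range_self _⟩) fun c d h ↦ ?_
  rw [← hr c, ← hr d]
  exact SimpleGraph.ConnectedComponent.sound (hf _ _ (congrArg Subtype.val h))

theorem cutDim_add_ncard (m : ℕ) {V : Type*} [Finite V] (G : SimpleGraph V) (T : Set V) :
    cutDim m G T + T.ncard =
      Nat.card V + Nat.card (G.induce Tᶜ).ConnectedComponent * (m - 1) := by
  have := Set.ncard_add_ncard_compl T
  rw [cutDim, Nat.card_coe_set_eq]
  lia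

namespace FanData

variable {n k : ℕ} {W : Finset (Fin n)} (F : FanData n k W)

/-- The pairs `(i, j)` indexing the attached complete graphs, and equally the elements of `W`. -/
abbrev Index : Type := (i : Fin k) × Fin (F.r i)

theorem card_index : Nat.card F.Index = W.card := by
  have : Set.range (fun p : F.Index ↦ F.w p.1 p.2) = W := by
    ext x
    simp [F.mem_W_iff, Sigma.exists]
  rw [← Set.ncard_coe_finset, ← this, ← Set.image_univ, Set.ncard_image_of_injective _ F.w_injective,
    Set.ncard_univ]

open Classical in
/-- For a set `D` of indices, the new vertices of `K_{a_{i,j}}` with `(i, j) ∈ D` are labelled by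
`(i, j)`, all other vertices by `none`. -/
noncomputable def label (D : Set F.Index) : F.Vert → Option F.Index
  | .inl _ => none
  | .inr v => if v.1 ∈ D then some v.1 else none

variable {F}

theorem adj_inl_inl {x y : Fin n} (h : x ≠ y) : F.graph.Adj (.inl x) (.inl y) :=
  ⟨by simpa using h, .inl ⟨⟨x, rfl⟩, ⟨y, rfl⟩⟩⟩

theorem adj_inr_inl (p : F.Index) (c : Fin (F.h p.1 p.2)) {l : Fin (F.r p.1)} (hl : l ≤ p.2) :
    F.graph.Adj (.inr ⟨p, c⟩) (.inl (F.w p.1 l)) :=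
  ⟨by simp, .inr ⟨p.1, p.2, .inr ⟨c, rfl⟩, .inl ⟨l, hl, rfl⟩⟩⟩

theorem adj_inr_inr (p : F.Index) {c d : Fin (F.h p.1 p.2)} (h : c ≠ d) :
    F.graph.Adj (.inr ⟨p, c⟩) (.inr ⟨p, d⟩) :=
  ⟨by simpa using h, .inr ⟨p.1, p.2, .inr ⟨c, rfl⟩, .inr ⟨d, rfl⟩⟩⟩

/-- If `D` contains with `(i, j)` all `(i, l)`, `l ≤ j`, then deleting the vertices `w_{i,j}` with
`(i, j) ∈ D` separates the new vertices of `K_{a_{i,j}}`, `(i, j) ∈ D`, from all the others. -/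
theorem label_eq_of_adj {D : Set F.Index}
    (hD : ∀ i (j l : Fin (F.r i)), l ≤ j → (⟨i, j⟩ : F.Index) ∈ D → (⟨i, l⟩ : F.Index) ∈ D)
    {u v : F.Vert} (hu : ∀ p ∈ D, u ≠ .inl (F.w p.1 p.2)) (hv : ∀ p ∈ D, v ≠ .inl (F.w p.1 p.2))
    (huv : F.graph.Adj u v) : F.label D u = F.label D v := by
  obtain ⟨-, ⟨⟨x, rfl⟩, ⟨y, rfl⟩⟩ | ⟨i, j, hui, hvi⟩⟩ := huv
  · rfl
  · have aux {u : F.Vert} (hu : ∀ p ∈ D, u ≠ .inl (F.w p.1 p.2)) (hui : u ∈ F.branch i j) :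
        F.label D u = F.label D (.inr ⟨⟨i, j⟩, ⟨0, Nat.sub_pos_of_lt (F.lt_a i j)⟩⟩) := by
      obtain ⟨l, hl, rfl⟩ | ⟨c, rfl⟩ := hui
      · have : (⟨i, j⟩ : F.Index) ∉ D := fun h ↦ hu ⟨i, l⟩ (hD i j l hl h) rfl
        simp [label, this]
      · rfl
    rw [aux hu hui, aux hv hvi]

/-- Deleting `w_{i,j}` for all `(i, j)` in a downward closed set `D` leaves at least `1 + |D|`
connected components, unless all of `K_n` is deleted. -/
theorem le_cutDim {m : ℕ} {D : Set F.Index}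
    (hD : ∀ i (j l : Fin (F.r i)), l ≤ j → (⟨i, j⟩ : F.Index) ∈ D → (⟨i, l⟩ : F.Index) ∈ D)
    {b : Fin n} (hb : ∀ p ∈ D, F.w p.1 p.2 ≠ b) :
    ∃ T, Nat.card F.Vert + (D.ncard + 1) * (m - 1) ≤ cutDim m F.graph T + D.ncard := by
  let T : Set F.Vert := (fun p : F.Index ↦ .inl (F.w p.1 p.2)) '' D
  have hT : T.ncard = D.ncard :=
    Set.ncard_image_of_injective _ (Sum.inl_injective.comp F.w_injective)
  have hT' {u : F.Vert} (hu : u ∈ Tᶜ) : ∀ p ∈ D, u ≠ .inl (F.w p.1 p.2) :=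
    fun p hp h ↦ hu ⟨p, hp, h.symm⟩
  have hle := SimpleGraph.ncard_range_le_card_connectedComponent
    (G := F.graph.induce Tᶜ) (fun v ↦ F.label D v)
    fun u v huv ↦ label_eq_of_adj hD (hT' u.2) (hT' v.2) (by simpa using huv)
  have hsub : insert none (some '' D) ⊆ Set.range fun v : ↥Tᶜ ↦ F.label D v := by
    rintro _ (rfl | ⟨p, hp, rfl⟩)
    · refine ⟨⟨.inl b, ?_⟩, rfl⟩
      rintro ⟨p, hp, h⟩
      exact hb p hp (Sum.inl_injective h)
    · exact ⟨⟨.inr ⟨p, ⟨0, Nat.sub_pos_of_lt (F.lt_a p.1 p.2)⟩⟩, by simp [T]⟩, by simp [label, hp]⟩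
  have hcard : D.ncard + 1 ≤ Nat.card (F.graph.induce Tᶜ).ConnectedComponent := by
    refine le_trans ?_ ((Set.ncard_le_ncard hsub).trans hle)
    rw [Set.ncard_insert_of_notMem (by simp), Set.ncard_image_of_injective _ (Option.some_injective _)]
  refine ⟨T, ?_⟩
  rw [← hT, cutDim_add_ncard, hT]
  gcongr

/-- Every component of `F_k^W(K_n) - T` that avoids `K_n` consists of new vertices of a single
`K_{a_{i,j}}` with `w_{i,1}, …, w_{i,j} ∈ T`. -/
theorem reachable_of_label_eq (T : Set F.Vert) (u v : ↥Tᶜ)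
    (huv : F.label {p | ∀ l ≤ p.2, .inl (F.w p.1 l) ∈ T} u =
      F.label {p | ∀ l ≤ p.2, .inl (F.w p.1 l) ∈ T} v) :
    (F.graph.induce Tᶜ).Reachable u v := by
  have adj {u v : ↥Tᶜ} (h : F.graph.Adj u v) : (F.graph.induce Tᶜ).Reachable u v :=
    SimpleGraph.Adj.reachable (by simpa using h)
  set D : Set F.Index := {p | ∀ l ≤ p.2, .inl (F.w p.1 l) ∈ T} with hD
  have hnone (u : ↥Tᶜ) (hu : F.label D u = none) :
      ∃ x, ∃ hx : .inl x ∈ Tᶜ, (F.graph.induce Tᶜ).Reachable u ⟨.inl x, hx⟩ := by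
    obtain ⟨x | ⟨p, c⟩, hmem⟩ := u
    · exact ⟨x, hmem, .rfl⟩
    · have hp : p ∉ D := fun h ↦ by simp [label, h] at hu
      simp only [hD, Set.mem_ofPred_eq, not_forall] at hp
      obtain ⟨l, hl, hlT⟩ := hp
      exact ⟨_, hlT, adj (adj_inr_inl p c hl)⟩
  cases h : F.label D u with
  | none =>
    obtain ⟨x, hx, hux⟩ := hnone u h
    obtain ⟨y, hy, hvy⟩ := hnone v (huv ▸ h)
    refine hux.trans (.trans ?_ hvy.symm)
    obtain rfl | hxy := eq_or_ne x y
    · rfl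
    · exact adj (adj_inl_inl hxy)
  | some p =>
    have hsome (u : ↥Tᶜ) (hu : F.label D u = some p) : ∃ c, u.1 = .inr ⟨p, c⟩ := by
      obtain ⟨x | ⟨q, c⟩, hmem⟩ := u
      · simp [label] at hu
      · obtain ⟨-, rfl⟩ : q ∈ D ∧ q = p := by simpa [label] using hu
        exact ⟨c, rfl⟩
    obtain ⟨c, hc⟩ := hsome u h
    obtain ⟨d, hd⟩ := hsome v (huv ▸ h)
    obtain rfl | hcd := eq_or_ne c d
    · rw [Subtype.ext (hc.trans hd.symm)]
    · exact adj (by rw [hc, hd]; exact adj_inr_inr p hcd)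

/-- Upper bound for the dimension of the component attached to a set `T` of vertices. There is at
most one component of `F_k^W(K_n) - T` meeting `K_n`, and none if `T` contains `K_n`; the number `d`
of the other components is at most the number of elements of `W` in `T`. -/
theorem cutDim_le {m : ℕ} (hm : 2 ≤ m) (T : Set F.Vert) :
    cutDim m F.graph T ≤ m + Nat.card F.Vert - 1 + min W.card (n - 1) * (m - 2) := by
  set D : Set F.Index := {p | ∀ l ≤ p.2, .inl (F.w p.1 l) ∈ T} with hD
  set B : Set (Fin n) := {x | .inl x ∈ T} with hB
  have hcc := SimpleGraph.card_connectedComponent_le_ncard_range _ (reachable_of_label_eq T)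
  have hBT : B.ncard ≤ T.ncard :=
    Set.ncard_le_ncard_of_injOn Sum.inl (fun x hx ↦ hx) Sum.inl_injective.injOn
  have hDB : D.ncard ≤ B.ncard :=
    Set.ncard_le_ncard_of_injOn (fun p ↦ F.w p.1 p.2) (fun p hp ↦ hp p.2 le_rfl) F.w_injective.injOn
  have hDW : D.ncard ≤ W.card := by
    rw [← F.card_index, ← Set.ncard_univ]
    exact Set.ncard_le_ncard (Set.subset_univ D)
  have hW : W.card ≤ n := by simpa using W.card_le_univ
  have hsome : (some '' D).ncard = D.ncard :=
    Set.ncard_image_of_injective _ (Option.some_injective _)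
  have hcut := cutDim_add_ncard m F.graph T
  obtain ⟨m, rfl⟩ := Nat.exists_eq_add_of_le' hm
  have hBn : B.ncard ≤ n := by simpa using Set.ncard_le_card B
  simp only [Nat.add_sub_cancel, show m + 2 - 1 = m + 1 from rfl] at hcut ⊢
  set c := Nat.card (F.graph.induce Tᶜ).ConnectedComponent
  set s := min W.card (n - 1) with hs
  -- If `T` misses a vertex of `K_n`, there are at most `d + 1` components and `d ≤ n - 1`;
  -- otherwise there are at most `d`, and `|T| ≥ n ≥ d`, where `d` may be `n`.
  obtain hlt | heq := hBn.lt_or_eq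
  · have hc : c ≤ D.ncard + 1 := by
      refine hcc.trans ((Set.ncard_le_ncard (t := insert none (some '' D)) ?_).trans ?_)
      · rintro _ ⟨⟨x | ⟨p, c⟩, hv⟩, rfl⟩
        · exact .inl rfl
        · by_cases hp : p ∈ D
          · exact .inr ⟨p, hp, by simp [label, ← hD, hp]⟩
          · exact .inl (by simp [label, ← hD, hp])
      · exact (Set.ncard_insert_le _ _).trans_eq (by rw [hsome])
    have hds : D.ncard ≤ s := by lia
    have h₁ : c * (m + 1) ≤ (D.ncard + 1) * (m + 1) := by gcongr
    have h₂ : D.ncard * m ≤ s * m := by gcongr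
    lia
  · have hBuniv : B = Set.univ := Set.eq_of_subset_of_ncard_le (Set.subset_univ B) (by simp [heq])
    have hc : c ≤ D.ncard := by
      refine hcc.trans ((Set.ncard_le_ncard (t := some '' D) ?_).trans_eq hsome)
      rintro _ ⟨⟨x | ⟨p, c⟩, hv⟩, rfl⟩
      · exact absurd (hBuniv ▸ Set.mem_univ x : x ∈ B) hv
      · have hp : p ∈ D := fun l _ ↦ (hBuniv ▸ Set.mem_univ _ : F.w p.1 l ∈ B)
        exact ⟨p, hp, by simp [label, ← hD, hp]⟩
    have hds : D.ncard ≤ s + 1 := by lia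
    have h₁ : c * (m + 1) ≤ D.ncard * (m + 1) := by gcongr
    have h₂ : D.ncard * m ≤ (s + 1) * m := by gcongr
    lia

/-- The bound is attained: delete all of `W`, except, if `W` is all of `K_n`, the last vertex
`w_{i,r_i}` of one part. -/
theorem exists_le_cutDim {m : ℕ} (hm : 2 ≤ m) (hn : 2 ≤ n) :
    ∃ T, m + Nat.card F.Vert - 1 + min W.card (n - 1) * (m - 2) ≤ cutDim m F.graph T := by
  suffices ∃ D : Set F.Index, (∀ i (j l : Fin (F.r i)), l ≤ j → (⟨i, j⟩ : F.Index) ∈ D →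
      (⟨i, l⟩ : F.Index) ∈ D) ∧ (∃ b, ∀ p ∈ D, F.w p.1 p.2 ≠ b) ∧
      D.ncard = min W.card (n - 1) by
    obtain ⟨D, hD, ⟨b, hb⟩, hcard⟩ := this
    obtain ⟨T, hT⟩ := le_cutDim (m := m) hD hb
    refine ⟨T, ?_⟩
    obtain ⟨m, rfl⟩ := Nat.exists_eq_add_of_le' hm
    rw [hcard] at hT
    simp only [Nat.add_sub_cancel, show m + 2 - 1 = m + 1 from rfl] at hT ⊢
    lia
  have hW : W.card ≤ n := by simpa using W.card_le_univ
  have hindex := F.card_index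
  obtain hlt | heq := hW.lt_or_eq
  · obtain ⟨b, hb⟩ : ∃ b, b ∉ W := by
      by_contra! h
      simp [Finset.eq_univ_of_forall h] at hlt
    refine ⟨Set.univ, by simp, ⟨b, fun p _ h ↦ hb ((F.mem_W_iff b).mpr ⟨p.1, p.2, h⟩)⟩, ?_⟩
    rw [Set.ncard_univ, hindex]
    lia
  · have : Nonempty F.Index := (Nat.card_pos_iff.mp (by lia)).1
    obtain ⟨i, -⟩ := Classical.arbitrary F.Index
    let last : F.Index := ⟨i, ⟨F.r i - 1, Nat.sub_one_lt (F.r_pos i).ne'⟩⟩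
    refine ⟨{last}ᶜ, ?_, ⟨F.w last.1 last.2, fun p hp h ↦ hp (F.w_injective h)⟩, ?_⟩
    · rintro i' j l hlj hj hl
      refine hj ?_
      obtain ⟨rfl, hl⟩ := Sigma.mk.inj_iff.mp hl
      obtain rfl := eq_of_heq hl
      have : j = ⟨F.r i' - 1, Nat.sub_one_lt (F.r_pos i').ne'⟩ :=
        le_antisymm (Nat.le_sub_one_of_lt j.2) hlj
      rw [this]; rfl
    · have := Set.ncard_add_ncard_compl {last}
      rw [Set.ncard_singleton] at this
      lia

end FanData

/-! ### The dimension formula for fan graphs -/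

/-- Throughout `m ≥ 2` and `n ≥ 2`, so the natural number subtractions do not truncate. -/
theorem mainTheorem7 {K : Type*} [Field K] {m n k : ℕ} (hm : 2 ≤ m) (hn : 2 ≤ n)
    {W : Finset (Fin n)} (F : FanData n k W)
    {V : Type*} [Fintype V] (G : SimpleGraph V) (hG : Nonempty (G ≃g F.graph)) :
    ringKrullDim (MvPolynomial (Fin m × V) K ⧸ genBinomialEdgeIdeal K m G) =
      ((m + Fintype.card V - 1 + min W.card (n - 1) * (m - 2) : ℕ) : WithBot ℕ∞) := by
  obtain ⟨e⟩ := hG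
  rw [← Nat.card_eq_fintype_card, Nat.card_congr e.toEquiv]
  apply le_antisymm
  · exact (e.symm.ringKrullDim_genBinomialEdgeIdeal_le K m).trans
      (ringKrullDim_le_of_forall_cutDim_le fun T ↦ FanData.cutDim_le hm T)
  · obtain ⟨T, hT⟩ := FanData.exists_le_cutDim (F := F) hm hn
    exact (Nat.cast_le.mpr hT).trans ((cutDim_le_ringKrullDim K F.graph T (by lia)).trans
      (e.ringKrullDim_genBinomialEdgeIdeal_le K m))
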